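/- For natural numbers $n,d,b$ put $$\mathfrak d_n(b)=(2b)^{2^n},\qquad \mathfrak e(n,b)=2^{(b+\mathfrak d_{n-1}(b))^{n-1}+1}\,b+b+\mathfrak d_{n-1}(b)\quad(n\ge 1),$$ $$\zeta_0(n,d)=\binom{n+\mathfrak d_n(d)}{n},\quad \zeta_1(n,d,b)=\Bigl(\binom{b+n}{n}+2\Bigr)\zeta_0(n,d),\quad \zeta_2(n,d,b)=(\zeta_1(n,d,b)+1)^{2^{\zeta_1(n,d,b)}-1}.$$ Define $\mathfrak p_n:\mathbb N\to\mathbb N$ recursively by $\mathfrak p_0(d)=\mathfrak p_1(d)=d$ and, for $n\ge 2$, $$\mathfrak p_n(d)=\max\Bigl\{2\binom{\upsilon(n,d)+n}{n}\upsilon(n,d),\ \mathfrak e(n-1,d)\Bigr\},\quad \upsilon(n,d)=\zeta_1(n-1,\mathfrak p_{n-1}(d),d)\,\zeta_2(n-1,\mathfrak p_{n-1}(d),d),$$ and let $\mathfrak p_n^i$ denote its $i$-fold iterate, $\mathfrak p_n^0(d)=d$. For $\mathbf D:\mathbb N\to\mathbb N$ with all values at least $1$, a finite multiset $\tau$ of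 natural numbers, $k\in\tau$ and $i\in\mathbb N$, let $\tau_{\langle k,i,\mathbf D\rangle}$ be obtained from $\tau$ by removing one copy of $k$ and, if $k>0$, adding $k\cdot(\mathbf D(i)-1)$ new copies of $k-1$. Define $\mathfrak m_{\tau,\mathbf D}(i)$ by well-founded recursion: $\mathfrak m_{\emptyset,\mathbf D}(i)=0$ and $\mathfrak m_{\tau,\mathbf D}(i)=1+\mathfrak m_{\tau_{\langle\min\tau,i,\mathbf D\rangle},\mathbf D}(i+1)$ for $\tau\ne\emptyset$. For any $\mathbf D:\mathbb N\to\mathbb N$ put $\mathfrak m^*(\mathbf D,n)=\mathfrak m_{\{n\},\mathbf D+1}(0)+1$. **Theorem.** Let $n,d\in\mathbb N$ and $m=\mathfrak m^*(i\mapsto\mathfrak p_n^i(d),\,n)$. Let $K$ be any field, let $\Lambda\subseteq K[X_1,\dots,X_n]$ be a set of polynomials of total degree at most $d$, and let $(\Lambda)$ be the ideal it generates. If $f\in K[X_1,\dots,X_n]$ (of arbitrary degree) satisfies $f^k\in(\Lambda)$ for some $k\in\mathbb N$, then there are finitely many $c_i,r_i\in K[X_1,\dots,X_n]$ such that $f=\sum_i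 c_ir_i$ and $r_i^{2^m}\in(\Lambda)$ for every $i$. -/

import Mathlib

namespace EffectiveRadical

/-- The bound `𝔡_n(b) = (2b)^(2^n)`. -/
def dBound (n b : ℕ) : ℕ := (2 * b) ^ 2 ^ n

/-- The bound `𝔢(n,b) = 2^((b + 𝔡_{n-1}(b))^(n-1) + 1) * b + b + 𝔡_{n-1}(b)`, for `1 ≤ n`. -/
def eBound (n b : ℕ) : ℕ :=
  2 ^ ((b + dBound (n - 1) b) ^ (n - 1) + 1) * b + b + dBound (n - 1) b

/-- `ζ₀(n,d)`, the number of monomials of degree at most `𝔡_n(d)` in `n` variables. -/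
def zeta0 (n d : ℕ) : ℕ := (n + dBound n d).choose n

/-- `ζ₁(n,d,b) = (binom(b+n, n) + 2) * ζ₀(n,d)`. -/
def zeta1 (n d b : ℕ) : ℕ := ((b + n).choose n + 2) * zeta0 n d

/-- `ζ₂(n,d,b) = (ζ₁(n,d,b) + 1)^(2^ζ₁(n,d,b) - 1)`. -/
def zeta2 (n d b : ℕ) : ℕ := (zeta1 n d b + 1) ^ (2 ^ zeta1 n d b - 1)

/-- The number `υ(n,d)`, for `2 ≤ n`, written as a function of `n`, of `q = 𝔭_{n-1}(d)`
and of `d`. -/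
def upsilon (n q d : ℕ) : ℕ := zeta1 (n - 1) q d * zeta2 (n - 1) q d

/-- The primality bound `𝔭_n(d)`: `𝔭_1(d) = d`, and for `2 ≤ n`
`𝔭_n(d) = max (2 * binom(υ(n,d)+n, n) * υ(n,d)) 𝔢(n-1,d)`.
For `n = 0`, where there are no variables, we put `𝔭_0(d) = d`; the values for
`1 ≤ n` do not depend on this. -/
def pBound : ℕ → ℕ → ℕ
  | 0, d => d
  | 1, d => d
  | n + 2, d =>
    max (2 * (upsilon (n + 2) (pBound (n + 1) d) d + (n + 2)).choose (n + 2)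
          * upsilon (n + 2) (pBound (n + 1) d) d)
      (eBound (n + 1) d)

/-- The multiset `τ_⟨k,i,D⟩`: for `0 < k`, remove one copy of `k` from `τ` and insert
`k * (D i - 1)` new copies of `k - 1`; for `k = 0`, just remove one copy of `0`. -/
def multisetStep (D : ℕ → ℕ) (τ : Multiset ℕ) (k i : ℕ) : Multiset ℕ :=
  if k = 0 then τ.erase 0
  else τ.erase k + Multiset.replicate (k * (D i - 1)) (k - 1)

/-- The least element of a nonempty finite multiset of natural numbers. -/
def multisetMin (τ : Multiset ℕ) (hτ : τ ≠ 0) : ℕ :=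
  τ.toFinset.min' (Multiset.toFinset_nonempty.2 hτ)

theorem multisetMin_mem (τ : Multiset ℕ) (hτ : τ ≠ 0) : multisetMin τ hτ ∈ τ :=
  Multiset.mem_toFinset.1 (Finset.min'_mem _ _)

/-- Replacing an element by finitely many copies of a smaller one (or by nothing) makes the
multiset smaller, so that the recursion defining `mBound` is well-founded. -/
theorem multisetStep_lt (D : ℕ → ℕ) (τ : Multiset ℕ) (k i : ℕ) (hk : k ∈ τ) :
    Multiset.IsDershowitzMannaLT (multisetStep D τ k i) τ := by
  by_cases h : k = 0
  · subst h
    refine ⟨τ.erase 0, 0, {0}, by simp, by simp [multisetStep], ?_, by simp⟩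
    rw [add_comm, Multiset.singleton_add, Multiset.cons_erase hk]
  · refine ⟨τ.erase k, Multiset.replicate (k * (D i - 1)) (k - 1), {k}, by simp,
      by simp [multisetStep, h], ?_, ?_⟩
    · rw [add_comm, Multiset.singleton_add, Multiset.cons_erase hk]
    · intro y hy
      have := Multiset.eq_of_mem_replicate hy
      exact ⟨k, by simp, by omega⟩

/-- The function `𝔪_{τ,D}(i)`: it is `0` if `τ = ∅`, and otherwise
`1 + 𝔪_{τ',D}(i+1)` with `τ' = τ_⟨min τ, i, D⟩`. -/
def mBound (D : ℕ → ℕ) (τ : Multiset ℕ) (i : ℕ) : ℕ :=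
  if hτ : τ = 0 then 0
  else 1 + mBound D (multisetStep D τ (multisetMin τ hτ) i) (i + 1)
termination_by τ
decreasing_by exact multisetStep_lt D τ _ i (multisetMin_mem τ hτ)

/-- `𝔪*(D,n) = 𝔪_{{n},D+1}(0) + 1`. -/
def mStar (D : ℕ → ℕ) (n : ℕ) : ℕ := mBound (fun i => D i + 1) {n} 0 + 1

end EffectiveRadical

/-!
The proof shows more than the statement asks: a power of `f` itself with exponent bounded in terms
of `n` and `d` lies in the ideal, so that `s = 1` and `r = f` do.

The bound holds more generally for nilpotent elements `f` of an algebra `S` that is finite over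
`A = K[X_1, …, X_r]`, generated by `M` elements whose module of relations is spanned by vectors
with entries of total degree at most `d` (`IsPresentation`). It is proved by induction on `r`.

* A maximal nonzero minor `δ` of the matrix of relations has degree at most `M * d`, and by
  Cramer's rule `δ` annihilates the torsion of `S` (`exists_det_smul_mem_span`). Over the fraction
  field of `A` the algebra has dimension at most `M`, so `f ^ M` is torsion
  (`exists_mul_pow_card_eq_zero`), and hence `δ * f ^ M = 0`.
* After Nagata's change of variables `δ` is monic in one variable (`exists_monic_nagataEquiv`), so
  that `S / δ S` is finite over a polynomial ring in `r - 1` variables. Division by `δ` gives a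
  presentation of it with controlled size and degrees (`IsPresentation.quotient`,
  `totalDegree_coeff_modByMonic_le`). By induction `f ^ N ∈ δ S` for a bounded `N`, and then
  `f ^ (N + M) = 0`.

Applied to `S = K[X_1, …, X_n] / (Λ)`, with the single generator `1`, this yields an exponent
`nilpotencyBound n 1 d`, which is at most `(d + 2) ^ (7 ^ n * n!)`. For `2 ≤ n` and
`1 ≤ d` the number `pBound n d` is at least doubly exponential in `d` and `n`, and two steps of the
recursion defining `mBound` already leave a multiset with at least `pBound n d` elements, each of
which costs one more step; this makes `2 ^ mStar` large enough. If `n ≤ 1` or `d = 0`, then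
`nilpotencyBound n 1 d` is at most `d + 1`, which is small enough.
-/

namespace EffectiveRadical

open Polynomial

/-! ### Presentations of finite algebras and their torsion -/

/-- The family `b` generates `S` as a module over `B` (acting through `φ`), and its `B`-linear
relations are spanned by the vectors in `Γ`. Keeping `φ` explicit, instead of an `Algebra B S`
instance, allows the base ring to be changed freely. -/
structure IsPresentation {B S ι : Type*} [CommRing B] [CommRing S] [Fintype ι]
    (φ : B →+* S) (b : ι → S) (Γ : Set (ι → B)) : Prop where
  exists_eq_sum : ∀ s : S, ∃ w : ι → B, s = ∑ i, φ (w i) * b i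
  sum_eq_zero_iff : ∀ w : ι → B, ∑ i, φ (w i) * b i = 0 ↔ w ∈ Submodule.span B Γ

/-- Cramer's rule over a domain: if bordering the nonzero minor `(γ, σ)` by `w` and any further
row gives determinant zero, then `w` times the minor is an explicit combination of the `γ j`, whose
coefficients are linear in `w`. -/
theorem det_smul_eq_sum_adjugate {B ι κ : Type*} [CommRing B] [IsDomain B] [Fintype κ]
    [DecidableEq κ] (γ : κ → ι → B) (σ : κ → ι)
    (hdet : (Matrix.of fun i j => γ j (σ i)).det ≠ 0) (w : ι → B)
    (hw : ∀ i, (Matrix.of fun (x y : κ ⊕ Unit) =>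
      (Sum.elim γ (fun _ => w) y) (Sum.elim σ (fun _ => i) x)).det = 0) :
    (Matrix.of fun i j => γ j (σ i)).det • w =
      ∑ j, ((Matrix.of fun i j => γ j (σ i)).adjugate.mulVec fun i => w (σ i)) j • γ j := by
  classical
  set G : Matrix κ κ B := Matrix.of fun i j => γ j (σ i) with hG
  set v : κ → B := G.adjugate.mulVec fun i => w (σ i) with hv
  ext i
  have hGv : G.mulVec v = G.det • fun i => w (σ i) := by
    rw [hv, Matrix.mulVec_mulVec, Matrix.mul_adjugate, Matrix.smul_mulVec, Matrix.one_mulVec]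
  have hN : (Matrix.of fun (x y : κ ⊕ Unit) =>
      (Sum.elim γ (fun _ => w) y) (Sum.elim σ (fun _ => i) x)) =
      Matrix.fromBlocks G (Matrix.of fun k (_ : Unit) => w (σ k))
        (Matrix.of fun (_ : Unit) k => γ k i) (Matrix.of fun (_ _ : Unit) => w i) := by
    ext (x | x) (y | y) <;> rfl
  have key := hw i
  rw [hN] at key
  -- clear the last column by the column operation that Cramer's rule suggests
  have hmul : Matrix.fromBlocks G (Matrix.of fun k (_ : Unit) => w (σ k))
        (Matrix.of fun (_ : Unit) k => γ k i) (Matrix.of fun (_ _ : Unit) => w i) *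
      Matrix.fromBlocks 1 (Matrix.of fun k (_ : Unit) => - v k) 0
        (Matrix.of fun (_ _ : Unit) => G.det) =
      Matrix.fromBlocks G 0 (Matrix.of fun (_ : Unit) k => γ k i)
        (Matrix.of fun (_ _ : Unit) => G.det * w i - ∑ j, v j * γ j i) := by
    rw [Matrix.fromBlocks_multiply]
    congr 1
    · simp
    · ext k u
      have := congrFun hGv k
      simp only [Matrix.mulVec, dotProduct, Pi.smul_apply, smul_eq_mul] at this
      simp [Matrix.mul_apply, this, mul_comm]
    · simp
    · ext u u'
      simp [Matrix.mul_apply, mul_comm]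
      ring
  have hd := congrArg Matrix.det hmul
  rw [Matrix.det_mul, key, zero_mul, Matrix.det_fromBlocks_zero₁₂] at hd
  have h0 := (mul_eq_zero.1 hd.symm).resolve_left hdet
  simp only [Matrix.det_unique, Matrix.of_apply] at h0
  simpa [sub_eq_zero] using h0

/-- A nonzero minor of maximal size among vectors of `Γ` annihilates the torsion modulo the
span of `Γ`, by Cramer's rule. -/
theorem exists_det_smul_mem_span {B ι : Type*} [CommRing B] [IsDomain B] [Fintype ι]
    (Γ : Set (ι → B)) :
    ∃ r ≤ Fintype.card ι, ∃ (γ : Fin r → ι → B) (σ : Fin r → ι), (∀ j, γ j ∈ Γ) ∧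
      (Matrix.of fun i j => γ j (σ i)).det ≠ 0 ∧
      ∀ (a : B) (w : ι → B), a ≠ 0 → a • w ∈ Submodule.span B Γ →
        (Matrix.of fun i j => γ j (σ i)).det • w ∈ Submodule.span B Γ := by
  classical
  let P : ℕ → Prop := fun r => ∃ (γ : Fin r → ι → B) (σ : Fin r → ι), (∀ j, γ j ∈ Γ) ∧
      (Matrix.of fun i j => γ j (σ i)).det ≠ 0
  have hP0 : P 0 := ⟨Fin.elim0, Fin.elim0, fun j => j.elim0, by simp⟩
  have hcard : ∀ r, P r → r ≤ Fintype.card ι := by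
    rintro r ⟨γ, σ, -, hd⟩
    have : Function.Injective σ := by
      intro i j hij
      by_contra hne
      exact hd (Matrix.det_zero_of_row_eq hne (by ext k; simp [hij]))
    simpa using Fintype.card_le_of_injective σ this
  have hPr := Nat.findGreatest_spec (P := P) (Nat.zero_le (Fintype.card ι)) hP0
  set r := Nat.findGreatest P (Fintype.card ι) with hr
  have hmax : ¬ P (r + 1) := fun h => by
    have := Nat.le_findGreatest (hcard _ h) h
    omega
  obtain ⟨γ, σ, hγ, hd⟩ := hPr
  refine ⟨r, Nat.findGreatest_le _, γ, σ, hγ, hd, ?_⟩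
  set G : Matrix (Fin r) (Fin r) B := Matrix.of fun i j => γ j (σ i) with hG
  -- Cramer's rule expresses `det G • w` linearly in `w`; this is an identity on `span Γ`.
  let F : (ι → B) →ₗ[B] (ι → B) := G.det • LinearMap.id -
    (Fintype.linearCombination B γ).comp (G.adjugate.mulVecLin.comp (LinearMap.funLeft B B σ))
  have hFapp : ∀ w, F w = G.det • w - ∑ j, (G.adjugate.mulVec fun i => w (σ i)) j • γ j := by
    intro w
    simp [F, Fintype.linearCombination_apply, LinearMap.funLeft, Function.comp_def]
  have hF : Submodule.span B Γ ≤ LinearMap.ker F := by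
    rw [Submodule.span_le]
    intro w hw
    rw [SetLike.mem_coe, LinearMap.mem_ker, hFapp, sub_eq_zero]
    refine det_smul_eq_sum_adjugate γ σ hd w fun i => ?_
    by_contra hne
    refine hmax ⟨fun j => Sum.elim γ (fun _ => w) ((finSumFinEquiv (m := r) (n := 1)).symm j
        |>.map id fun _ => ()), fun j => Sum.elim σ (fun _ => i)
        ((finSumFinEquiv (m := r) (n := 1)).symm j |>.map id fun _ => ()), ?_, ?_⟩
    · intro j
      beta_reduce
      rcases (finSumFinEquiv (m := r) (n := 1)).symm j with k | k
      · exact hγ k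
      · exact hw
    · rw [← Matrix.det_submatrix_equiv_self
        ((Equiv.sumCongr (Equiv.refl (Fin r)) (Equiv.equivPUnit (Fin 1)).symm).trans
          finSumFinEquiv)]
      convert hne using 2
      ext x y
      rcases x with x | x <;> rcases y with y | y <;> simp
  intro a w ha hw
  have h0 : F w = 0 := by
    have := hF hw
    rw [LinearMap.mem_ker, map_smul] at this
    exact (smul_eq_zero.1 this).resolve_left ha
  rw [hFapp, sub_eq_zero] at h0
  rw [h0]
  exact Submodule.sum_mem _ fun j _ => Submodule.smul_mem _ _ (Submodule.subset_span (hγ j))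

/-- Over the fraction field of `B`, the algebra `S` has dimension at most `card ι`, which bounds
the nilpotency index of a nilpotent element up to torsion. -/
theorem exists_mul_pow_card_eq_zero {B S ι : Type*} [CommRing B] [IsDomain B] [CommRing S]
    [Fintype ι] (φ : B →+* S) (b : ι → S) (hb : ∀ s : S, ∃ w : ι → B, s = ∑ i, φ (w i) * b i)
    (f : S) (hf : IsNilpotent f) : ∃ a : B, a ≠ 0 ∧ φ a * f ^ Fintype.card ι = 0 := by
  let _ := φ.toAlgebra
  let L := FractionRing B
  let V := TensorProduct B L S
  let M := nonZeroDivisors B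
  have hspan : Submodule.span L (Set.range fun i => (1 : L) ⊗ₜ[B] b i) = (⊤ : Submodule L V) := by
    have htop : Submodule.span B (Set.range b) = ⊤ := by
      rw [eq_top_iff]
      rintro s -
      obtain ⟨w, rfl⟩ := hb s
      refine Submodule.sum_mem _ fun i _ => ?_
      have : φ (w i) * b i = w i • b i := by rw [Algebra.smul_def]; rfl
      rw [this]
      exact Submodule.smul_mem _ _ (Submodule.subset_span ⟨i, rfl⟩)
    have h := Submodule.baseChange_span (R := B) L (Set.range b)
    rw [htop, Submodule.baseChange_top] at h
    rw [h, ← Set.range_comp]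
    rfl
  have : Module.Finite L V := ⟨by
    rw [← hspan]; exact Submodule.fg_span (Set.finite_range _)⟩
  have hdim : Module.finrank L V ≤ Fintype.card ι := by
    rw [← finrank_top, ← hspan]
    exact finrank_range_le_card _
  let g : V := (1 : L) ⊗ₜ[B] f
  have hg : IsNilpotent g := hf.map (Algebra.TensorProduct.includeRight (R := B) (A := L) (B := S))
  have hmul : IsNilpotent (LinearMap.mulLeft L g) := by
    obtain ⟨k, hk⟩ := hg
    exact ⟨k, by rw [LinearMap.pow_mulLeft, hk, LinearMap.mulLeft_zero_eq_zero]⟩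
  have hpow : g ^ Fintype.card ι = 0 := by
    have h1 := LinearMap.aeval_self_charpoly (LinearMap.mulLeft L g)
    rw [LinearMap.charpoly_eq_X_pow_iff _ |>.2 (fun m => ?_)] at h1
    · rw [map_pow, aeval_X, LinearMap.pow_mulLeft] at h1
      have h2 : g ^ Module.finrank L V = 0 := by
        simpa using congrArg (fun F => F 1) h1
      exact pow_eq_zero_of_le hdim h2
    · obtain ⟨k, hk⟩ := hmul
      exact ⟨k, by rw [hk]; rfl⟩
  have hpow' : TensorProduct.mk B L S 1 (f ^ Fintype.card ι) = 0 := by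
    rw [← hpow, Algebra.TensorProduct.tmul_pow, one_pow, TensorProduct.mk_apply]
  obtain ⟨a, ha⟩ := (IsLocalizedModule.eq_zero_iff M (TensorProduct.mk B L S 1)).1 hpow'
  refine ⟨a, nonZeroDivisors.ne_zero a.2, ?_⟩
  rw [← ha, Submonoid.smul_def, Algebra.smul_def]
  rfl

theorem apply_mem_span_image {B B' ι : Type*} [CommRing B] [CommRing B'] (e : B ≃+* B')
    {Γ : Set (ι → B)} {w : ι → B} (hw : w ∈ Submodule.span B Γ) :
    (fun i => e (w i)) ∈ Submodule.span B' ((fun w i => e (w i)) '' Γ) := by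
  induction hw using Submodule.span_induction with
  | mem x hx => exact Submodule.subset_span ⟨x, hx, rfl⟩
  | zero => simp only [Pi.zero_apply, map_zero]; exact Submodule.zero_mem _
  | add x y _ _ hx hy =>
    convert Submodule.add_mem _ hx hy using 1
    ext i; simp
  | smul a x _ hx =>
    convert Submodule.smul_mem _ (e a) hx using 1
    ext i; simp

namespace IsPresentation

variable {B B' S ι : Type*} [CommRing B] [CommRing B'] [CommRing S] [Fintype ι]

theorem mul_pow_card_eq_zero [IsDomain B] {φ : B →+* S} {b : ι → S} {Γ : Set (ι → B)}
    (h : IsPresentation φ b Γ) (δ : B)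
    (hδ : ∀ (a : B) (w : ι → B), a ≠ 0 → a • w ∈ Submodule.span B Γ → δ • w ∈ Submodule.span B Γ)
    {f : S} (hf : IsNilpotent f) : φ δ * f ^ Fintype.card ι = 0 := by
  obtain ⟨a, ha, h0⟩ := exists_mul_pow_card_eq_zero φ b h.exists_eq_sum f hf
  obtain ⟨w, hw⟩ := h.exists_eq_sum (f ^ Fintype.card ι)
  have hsmul : ∀ c : B, φ c * f ^ Fintype.card ι = ∑ i, φ ((c • w) i) * b i := by
    intro c
    rw [hw, Finset.mul_sum]
    exact Finset.sum_congr rfl fun i _ => by simp [mul_assoc]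
  rw [hsmul, h.sum_eq_zero_iff]
  refine hδ a w ha ?_
  rwa [← h.sum_eq_zero_iff, ← hsmul]

theorem comp_symm {φ : B →+* S} {b : ι → S} {Γ : Set (ι → B)}
    (h : IsPresentation φ b Γ) (e : B ≃+* B') :
    IsPresentation (φ.comp e.symm.toRingHom) b ((fun w i => e (w i)) '' Γ) := by
  refine ⟨fun s => ?_, fun w => ?_⟩
  · obtain ⟨w, hw⟩ := h.exists_eq_sum s
    exact ⟨fun i => e (w i), by simpa using hw⟩
  · have := h.sum_eq_zero_iff fun i => e.symm (w i)
    refine Iff.trans (by simp) (this.trans ⟨fun hw => ?_, fun hw => ?_⟩)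
    · simpa using apply_mem_span_image e hw
    · have := apply_mem_span_image e.symm hw
      simpa [Set.image_image] using this

end IsPresentation

/-! ### Reduction modulo a monic polynomial -/

theorem sum_C_coeff_mul_X_pow {B : Type*} [CommRing B] (D : ℕ) (q : B[X])
    (hq : ∀ k, D ≤ k → q.coeff k = 0) : ∑ j : Fin D, C (q.coeff j) * X ^ (j : ℕ) = q := by
  rw [Fin.sum_univ_eq_sum_range fun j => C (q.coeff j) * X ^ j]
  ext k
  simp only [finsetSum_coeff, coeff_C_mul_X_pow]
  by_cases hk : k < D
  · simp [hk]
  · rw [hq k (not_lt.1 hk)]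
    simp [hk]

theorem coeff_modByMonic_eq_zero {B : Type*} [CommRing B] [Nontrivial B] {δ : B[X]}
    (hδ : δ.Monic) (p : B[X]) {k : ℕ} (hk : δ.natDegree ≤ k) : (p %ₘ δ).coeff k = 0 :=
  coeff_eq_zero_of_degree_lt <| (degree_modByMonic_lt p hδ).trans_le <| by
    rw [degree_eq_natDegree hδ.ne_zero]; exact_mod_cast hk

/-- Coordinates of vectors over `B[X]` modulo `δ`, in the basis `1, X, X ^ 2, …` of
`B[X] / (δ)` over `B`. -/
noncomputable def remainderCoeffs {B : Type*} [CommRing B] (ι : Type*) (δ : B[X]) :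
    (ι → B[X]) →ₗ[B] (ι × Fin δ.natDegree → B) where
  toFun p x := (p x.1 %ₘ δ).coeff x.2
  map_add' p q := by ext x; simp [add_modByMonic]
  map_smul' a p := by ext x; simp [smul_modByMonic]

/-- Relations over `B` between the elements `b i * X ^ j`, obtained from relations over `B[X]`
between the `b i` by reduction modulo `δ`. -/
def reducedRelations {B ι : Type*} [CommRing B] (Γ : Set (ι → B[X])) (δ : B[X]) :
    Set (ι × Fin δ.natDegree → B) :=
  {w | ∃ γ ∈ Γ, ∃ k < δ.natDegree, w = remainderCoeffs ι δ fun i => X ^ k * γ i}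

theorem remainderCoeffs_mem_span {B ι : Type*} [CommRing B] [Nontrivial B] {Γ : Set (ι → B[X])}
    {δ : B[X]} (hδ : δ.Monic) {p : ι → B[X]} (hp : p ∈ Submodule.span B[X] Γ) :
    remainderCoeffs ι δ p ∈ Submodule.span B (reducedRelations Γ δ) := by
  induction hp using Submodule.closure_induction with
  | zero => simp
  | add x y _ _ hx hy => rw [map_add]; exact Submodule.add_mem _ hx hy
  | smul_mem q γ hγ =>
    have h1 : remainderCoeffs ι δ (q • γ) = ∑ j : Fin δ.natDegree, (q %ₘ δ).coeff j •
        remainderCoeffs ι δ fun i => X ^ (j : ℕ) * γ i := by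
      simp_rw [← map_smul, ← map_sum]
      ext x
      simp only [remainderCoeffs, LinearMap.coe_mk, AddHom.coe_mk, Pi.smul_apply,
        Finset.sum_apply, smul_eq_mul]
      have h2 : ∑ j : Fin δ.natDegree, (q %ₘ δ).coeff j • (X ^ (j : ℕ) * γ x.1) =
          (q %ₘ δ) * γ x.1 := by
        conv_rhs => rw [← sum_C_coeff_mul_X_pow δ.natDegree (q %ₘ δ)
          fun k => coeff_modByMonic_eq_zero hδ q, Finset.sum_mul]
        simp only [smul_eq_C_mul, mul_assoc]
      rw [h2]
      congr 1
      refine modByMonic_eq_of_dvd_sub hδ ⟨(q /ₘ δ) * γ x.1, ?_⟩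
      linear_combination (- γ x.1) * modByMonic_add_div q δ
    rw [h1]
    exact Submodule.sum_mem _ fun j _ => Submodule.smul_mem _ _ <|
      Submodule.subset_span ⟨γ, hγ, j, j.2, rfl⟩

/-- If `S` is finite over `B[X]` and `δ` is monic, then `S / δ S` is finite over `B`, and a
presentation results by reducing the old one modulo `δ`. -/
theorem IsPresentation.quotient {B S ι : Type*} [CommRing B] [Nontrivial B] [CommRing S]
    [Fintype ι] {φ : B[X] →+* S} {b : ι → S} {Γ : Set (ι → B[X])} (h : IsPresentation φ b Γ)
    {δ : B[X]} (hδ : δ.Monic) (J : Ideal S) (hJ : J = Ideal.span {φ δ}) :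
    IsPresentation ((Ideal.Quotient.mk J).comp (φ.comp C))
      (fun x : ι × Fin δ.natDegree => Ideal.Quotient.mk J (φ (X ^ (x.2 : ℕ)) * b x.1))
      (reducedRelations Γ δ) := by
  have hsum : ∀ w : ι × Fin δ.natDegree → B,
      ∑ x, ((Ideal.Quotient.mk J).comp (φ.comp C)) (w x) *
        Ideal.Quotient.mk J (φ (X ^ (x.2 : ℕ)) * b x.1) =
      Ideal.Quotient.mk J (∑ i, φ (∑ j : Fin δ.natDegree, C (w (i, j)) * X ^ (j : ℕ)) * b i) := by
    intro w
    rw [Fintype.sum_prod_type]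
    simp [Finset.sum_mul, mul_assoc]
  have hmod : ∀ p : ι → B[X], Ideal.Quotient.mk J (∑ i, φ (p i %ₘ δ) * b i) =
      Ideal.Quotient.mk J (∑ i, φ (p i) * b i) := by
    intro p
    rw [Ideal.Quotient.eq, ← Finset.sum_sub_distrib]
    refine Ideal.sum_mem _ fun i _ => ?_
    rw [← sub_mul, ← map_sub, hJ]
    refine Ideal.mul_mem_right _ _ (Ideal.mem_span_singleton.2 (map_dvd φ ?_))
    refine ⟨- (p i /ₘ δ), ?_⟩
    linear_combination modByMonic_add_div (p i) δ
  have hrem : ∀ p : ι → B[X], ∑ x, ((Ideal.Quotient.mk J).comp (φ.comp C))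
      (remainderCoeffs ι δ p x) * Ideal.Quotient.mk J (φ (X ^ (x.2 : ℕ)) * b x.1) =
      Ideal.Quotient.mk J (∑ i, φ (p i) * b i) := by
    intro p
    rw [hsum, ← hmod p]
    refine congrArg _ (Finset.sum_congr rfl fun i _ => ?_)
    exact congrArg (fun z => φ z * b i) <|
      sum_C_coeff_mul_X_pow δ.natDegree (p i %ₘ δ) fun k => coeff_modByMonic_eq_zero hδ _
  refine ⟨fun s => ?_, fun w => ⟨fun hw => ?_, fun hw => ?_⟩⟩
  · obtain ⟨s, rfl⟩ := Ideal.Quotient.mk_surjective s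
    obtain ⟨p, rfl⟩ := h.exists_eq_sum s
    exact ⟨remainderCoeffs ι δ p, (hrem p).symm⟩
  · rw [hsum, Ideal.Quotient.eq_zero_iff_mem, hJ, Ideal.mem_span_singleton] at hw
    obtain ⟨s, hs⟩ := hw
    obtain ⟨q, rfl⟩ := h.exists_eq_sum s
    have hmem : (fun i => ∑ j : Fin δ.natDegree, C (w (i, j)) * X ^ (j : ℕ) - δ * q i) ∈
        Submodule.span B[X] Γ := by
      rw [← h.sum_eq_zero_iff]
      simp only [map_sub, sub_mul, Finset.sum_sub_distrib, hs, Finset.mul_sum, map_mul, mul_assoc,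
        sub_self]
    convert remainderCoeffs_mem_span hδ hmem
    ext ⟨i, j⟩
    have h1 : (∑ j : Fin δ.natDegree, C (w (i, j)) * X ^ (j : ℕ)).degree < δ.degree := by
      rw [degree_eq_natDegree hδ.ne_zero]
      exact degree_sum_fin_lt fun j => w (i, j)
    simp only [remainderCoeffs, LinearMap.coe_mk, AddHom.coe_mk]
    rw [sub_modByMonic, self_mul_modByMonic hδ, sub_zero, (modByMonic_eq_self_iff hδ).2 h1,
      finsetSum_coeff]
    simp [coeff_X_pow, Fin.val_inj]
  · induction hw using Submodule.span_induction with
    | mem x hx =>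
      obtain ⟨γ, hγ, k, -, rfl⟩ := hx
      have h0 := (h.sum_eq_zero_iff γ).2 (Submodule.subset_span hγ)
      rw [hrem]
      simp [mul_assoc, ← Finset.mul_sum, h0]
    | zero => simp
    | add x y _ _ hx hy => simp_all [add_mul, Finset.sum_add_distrib]
    | smul a x _ hx =>
      simp only [Pi.smul_apply, smul_eq_mul, map_mul, mul_assoc, ← Finset.mul_sum] at hx ⊢
      rw [hx, mul_zero]

/-- Each step of the division by `δ` raises the total degree of the coefficients by at most `g`. -/
theorem totalDegree_coeff_modByMonic_le {R σ : Type*} [CommRing R] [Nontrivial R]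
    {δ : (MvPolynomial σ R)[X]} (hδ : δ.Monic) {g : ℕ} (hg : ∀ k, (δ.coeff k).totalDegree ≤ g)
    (N : ℕ) : ∀ (c : ℕ) (p : (MvPolynomial σ R)[X]), p.degree < N →
      (∀ k, (p.coeff k).totalDegree ≤ c) → ∀ k, ((p %ₘ δ).coeff k).totalDegree ≤ c + N * g := by
  induction N with
  | zero =>
    intro c p hp _ k
    have : p = 0 := by
      rw [← degree_eq_bot]
      exact Nat.WithBot.lt_zero_iff.1 (by simpa using hp)
    simp [this]
  | succ N ih =>
    intro c p hp hc k
    by_cases hN : N + 1 ≤ δ.natDegree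
    · rw [(modByMonic_eq_self_iff hδ).2]
      · exact (hc k).trans (Nat.le_add_right _ _)
      · rw [degree_eq_natDegree hδ.ne_zero]
        exact hp.trans_le (by exact_mod_cast hN)
    · have hN : δ.natDegree ≤ N := by omega
      -- one step of the division algorithm
      set p' := p - C (p.coeff N) * X ^ (N - δ.natDegree) * δ with hp'
      have hmod : p %ₘ δ = p' %ₘ δ := by
        rw [hp', sub_modByMonic, mul_self_modByMonic hδ, sub_zero]
      have hcoeff : ∀ k, p'.coeff k =
          p.coeff k - p.coeff N * (X ^ (N - δ.natDegree) * δ).coeff k := by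
        intro k
        rw [hp', coeff_sub, mul_assoc, coeff_C_mul]
      have hdeg : p'.degree < N := by
        rw [degree_lt_iff_coeff_zero]
        intro m hm
        rw [hcoeff, coeff_X_pow_mul']
        rcases hm.eq_or_lt with rfl | hm
        · rw [if_pos (Nat.sub_le _ _), Nat.sub_sub_self hN, hδ.coeff_natDegree, mul_one, sub_self]
        · rw [if_pos (by omega), coeff_eq_zero_of_natDegree_lt (p := δ) (by omega), mul_zero,
            sub_zero]
          exact coeff_eq_zero_of_degree_lt (hp.trans_le (by exact_mod_cast hm))
      rw [hmod]
      refine (ih (c + g) p' hdeg (fun k => ?_) k).trans (le_of_eq (by ring))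
      rw [hcoeff, coeff_X_pow_mul']
      refine (MvPolynomial.totalDegree_sub _ _).trans (max_le ((hc k).trans (by omega)) ?_)
      refine (MvPolynomial.totalDegree_mul _ _).trans (Nat.add_le_add (hc N) ?_)
      split_ifs
      · exact hg _
      · simp

/-! ### The change of variables, and the bound on nilpotency indices -/

theorem totalDegree_det_le {R σ κ : Type*} [CommRing R] [Fintype κ] [DecidableEq κ]
    (A : Matrix κ κ (MvPolynomial σ R)) {d : ℕ} (hA : ∀ i j, (A i j).totalDegree ≤ d) :
    A.det.totalDegree ≤ Fintype.card κ * d := by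
  rw [Matrix.det_apply]
  refine MvPolynomial.totalDegree_finsetSum_le fun τ _ => ?_
  refine (MvPolynomial.totalDegree_smul_le _ _).trans ?_
  refine (MvPolynomial.totalDegree_finsetProd _ _).trans ?_
  refine (Finset.sum_le_sum fun i _ => hA _ _).trans ?_
  simp

/-- Base-`e` expansions are unique; `Nat.ofDigits_inj_of_len_eq` does not cover `e = 1`. -/
theorem eq_of_sum_pow_mul_eq {e : ℕ} : ∀ {n : ℕ} {v w : Fin n → ℕ}, (∀ i, v i < e) →
    (∀ i, w i < e) → ∑ i : Fin n, e ^ (i : ℕ) * v i = ∑ i : Fin n, e ^ (i : ℕ) * w i → v = w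
  | 0, v, w, _, _, _ => Subsingleton.elim v w
  | n + 1, v, w, hv, hw, h => by
    have hs : ∀ u : Fin (n + 1) → ℕ, ∑ i : Fin (n + 1), e ^ (i : ℕ) * u i =
        u 0 + e * ∑ i : Fin n, e ^ (i : ℕ) * u i.succ := by
      intro u
      rw [Fin.sum_univ_succ, Finset.mul_sum]
      simp [pow_succ', mul_assoc]
    rw [hs, hs] at h
    have h0 : v 0 = w 0 := by
      have := congrArg (· % e) h
      simpa [Nat.add_mul_mod_self_left, Nat.mod_eq_of_lt, hv, hw] using this
    have he : 0 < e := (Nat.zero_le _).trans_lt (hv 0)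
    have ht := eq_of_sum_pow_mul_eq (fun i => hv i.succ) (fun i => hw i.succ)
      (Nat.eq_of_mul_eq_mul_left he (by omega))
    ext i
    refine Fin.cases h0 (fun j => congrFun ht j) i

/-- The endomorphism with `X 0 ↦ X 0` and `X i ↦ X i + c * X 0 ^ (e ^ i)` for `i ≠ 0`. -/
noncomputable def nagataHom {K : Type*} [Field K] (n e : ℕ) (c : K) :
    MvPolynomial (Fin (n + 1)) K →ₐ[K] MvPolynomial (Fin (n + 1)) K :=
  MvPolynomial.aeval fun i => if i = 0 then MvPolynomial.X 0
    else MvPolynomial.X i + c • MvPolynomial.X 0 ^ e ^ (i : ℕ)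

theorem nagataHom_comp_nagataHom_neg {K : Type*} [Field K] (n e : ℕ) (c : K) :
    (nagataHom n e c).comp (nagataHom n e (-c)) = AlgHom.id _ _ := by
  refine MvPolynomial.algHom_ext fun i => ?_
  refine Fin.cases ?_ (fun j => ?_) i <;> simp [nagataHom]

/-- The change of variables behind Noether normalization over an arbitrary field, followed by the
identification of `K[X_0, …, X_n]` with the polynomial ring in `X_0` over the others. -/
noncomputable def nagataEquiv (K : Type*) [Field K] (n e : ℕ) :
    MvPolynomial (Fin (n + 1)) K ≃ₐ[K] (MvPolynomial (Fin n) K)[X] :=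
  (AlgEquiv.ofAlgHom (nagataHom n e 1) (nagataHom n e (-1)) (nagataHom_comp_nagataHom_neg n e 1)
    (by have h := nagataHom_comp_nagataHom_neg n e (-1 : K); rwa [neg_neg] at h)).trans
    (MvPolynomial.finSuccEquiv K n)

theorem nagataEquiv_apply {K : Type*} [Field K] (n e : ℕ) (p : MvPolynomial (Fin (n + 1)) K) :
    nagataEquiv K n e p = MvPolynomial.finSuccEquiv K n (nagataHom n e 1 p) := rfl

theorem totalDegree_nagataHom_le {K : Type*} [Field K] (n : ℕ) {e : ℕ} (he : 0 < e)
    (p : MvPolynomial (Fin (n + 1)) K) :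
    (nagataHom n e 1 p).totalDegree ≤ p.totalDegree * e ^ n := by
  have hX : ∀ i : Fin (n + 1), (nagataHom n e (1 : K) (MvPolynomial.X i)).totalDegree ≤ e ^ n := by
    intro i
    have h1 : 1 ≤ e ^ n := Nat.one_le_pow _ _ he
    simp only [nagataHom, MvPolynomial.aeval_X, one_smul]
    split_ifs
    · simpa using h1
    · refine (MvPolynomial.totalDegree_add _ _).trans (max_le (by simpa using h1) ?_)
      rw [MvPolynomial.totalDegree_X_pow]
      exact Nat.pow_le_pow_right he (by omega)
  conv_lhs => rw [p.as_sum, map_sum]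
  refine MvPolynomial.totalDegree_finsetSum_le fun v hv => ?_
  rw [MvPolynomial.monomial_eq, Finsupp.prod_fintype _ _ (by simp), map_mul, map_prod]
  refine (MvPolynomial.totalDegree_mul _ _).trans ?_
  rw [MvPolynomial.algHom_C, MvPolynomial.algebraMap_eq, MvPolynomial.totalDegree_C, zero_add]
  refine (MvPolynomial.totalDegree_finsetProd _ _).trans ?_
  calc ∑ i, (nagataHom n e (1 : K) (MvPolynomial.X i ^ v i)).totalDegree
      ≤ ∑ i, v i * e ^ n := Finset.sum_le_sum fun i _ => by
        rw [map_pow]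
        exact (MvPolynomial.totalDegree_pow _ _).trans (Nat.mul_le_mul_left _ (hX i))
    _ = (∑ i, v i) * e ^ n := (Finset.sum_mul _ _ _).symm
    _ ≤ p.totalDegree * e ^ n := by
        refine Nat.mul_le_mul_right _ ?_
        have := MvPolynomial.le_totalDegree hv
        rwa [Finsupp.sum_fintype _ _ (by simp)] at this

theorem natDegree_nagataEquiv_le {K : Type*} [Field K] (n : ℕ) {e : ℕ} (he : 0 < e)
    (p : MvPolynomial (Fin (n + 1)) K) :
    (nagataEquiv K n e p).natDegree ≤ p.totalDegree * e ^ n := by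
  rw [nagataEquiv_apply, MvPolynomial.natDegree_finSuccEquiv]
  exact (MvPolynomial.degreeOf_le_totalDegree _ _).trans (totalDegree_nagataHom_le n he p)

theorem totalDegree_coeff_nagataEquiv_le {K : Type*} [Field K] (n : ℕ) {e : ℕ} (he : 0 < e)
    (p : MvPolynomial (Fin (n + 1)) K) (k : ℕ) :
    ((nagataEquiv K n e p).coeff k).totalDegree ≤ p.totalDegree * e ^ n := by
  rw [nagataEquiv_apply]
  by_cases h : (MvPolynomial.finSuccEquiv K n (nagataHom n e 1 p)).coeff k = 0
  · simp [h]
  · exact (Nat.le_add_right _ k).trans <|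
      (MvPolynomial.totalDegree_coeff_finSuccEquiv_add_le _ k h).trans
        (totalDegree_nagataHom_le n he p)

/-- Monomials go to monic polynomials whose degrees are read off from base-`e` expansions. -/
theorem nagataEquiv_prod_X_pow {K : Type*} [Field K] (n : ℕ) {e : ℕ} (he : 0 < e)
    (v : Fin (n + 1) → ℕ) :
    (nagataEquiv K n e (∏ i, MvPolynomial.X i ^ v i)).Monic ∧
    (nagataEquiv K n e (∏ i, MvPolynomial.X i ^ v i)).natDegree =
      ∑ i : Fin (n + 1), e ^ (i : ℕ) * v i := by
  have hX : ∀ i : Fin (n + 1), (nagataEquiv K n e (MvPolynomial.X i)).Monic ∧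
      (nagataEquiv K n e (MvPolynomial.X i)).natDegree = e ^ (i : ℕ) := by
    intro i
    rw [nagataEquiv_apply]
    refine Fin.cases ?_ (fun j => ?_) i
    · simp [nagataHom, MvPolynomial.finSuccEquiv_X_zero, monic_X]
    · have h : MvPolynomial.finSuccEquiv K n (nagataHom n e 1 (MvPolynomial.X j.succ)) =
          X ^ e ^ (j.succ : ℕ) + C (MvPolynomial.X j) := by
        simp [nagataHom, MvPolynomial.finSuccEquiv_X_zero, MvPolynomial.finSuccEquiv_X_succ,
          add_comm]
      rw [h]
      exact ⟨monic_X_pow_add_C _ (pow_pos he _).ne', natDegree_X_pow_add_C⟩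
  simp only [map_prod, map_pow]
  refine ⟨monic_prod_of_monic _ _ fun i _ => (hX i).1.pow _, ?_⟩
  rw [natDegree_prod_of_monic _ _ fun i _ => (hX i).1.pow _]
  exact Finset.sum_congr rfl fun i _ => by rw [(hX i).1.natDegree_pow, (hX i).2, mul_comm]

/-- Distinct monomials of `p` get distinct degrees in `X 0`, so the top one cannot cancel. -/
theorem exists_monic_nagataEquiv {K : Type*} [Field K] (n : ℕ) {e : ℕ}
    {p : MvPolynomial (Fin (n + 1)) K} (hp : p ≠ 0) (he : p.totalDegree < e) :
    ∃ c : K, c ≠ 0 ∧ (nagataEquiv K n e (MvPolynomial.C c * p)).Monic := by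
  have he0 : 0 < e := (Nat.zero_le _).trans_lt he
  let wt : (Fin (n + 1) →₀ ℕ) → ℕ := fun v => ∑ i : Fin (n + 1), e ^ (i : ℕ) * v i
  obtain ⟨v, hv, hmax⟩ := Finset.exists_max_image p.support wt
    (MvPolynomial.support_nonempty.2 hp)
  have hlt : ∀ u ∈ p.support, ∀ i, u i < e := fun u hu i =>
    ((MvPolynomial.monomial_le_degreeOf i hu).trans
      (MvPolynomial.degreeOf_le_totalDegree p i)).trans_lt he
  have hne : ∀ u ∈ p.support, u ≠ v → wt u < wt v := fun u hu huv =>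
    lt_of_le_of_ne (hmax u hu) fun h =>
      huv (DFunLike.coe_injective (eq_of_sum_pow_mul_eq (hlt u hu) (hlt v hv) h))
  have hc : p.coeff v ≠ 0 := MvPolynomial.mem_support_iff.1 hv
  refine ⟨(p.coeff v)⁻¹, inv_ne_zero hc, ?_⟩
  have hsum : nagataEquiv K n e (MvPolynomial.C (p.coeff v)⁻¹ * p) =
      ∑ u ∈ p.support, C (MvPolynomial.C ((p.coeff v)⁻¹ * p.coeff u)) *
        nagataEquiv K n e (∏ i, MvPolynomial.X i ^ u i) := by
    have hC : ∀ a : K, nagataEquiv K n e (MvPolynomial.C a) = C (MvPolynomial.C a) :=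
      (nagataEquiv K n e).commutes
    generalize (p.coeff v)⁻¹ = a
    conv_lhs => rw [p.as_sum, Finset.mul_sum, map_sum]
    refine Finset.sum_congr rfl fun u _ => ?_
    rw [MvPolynomial.monomial_eq, Finsupp.prod_fintype _ _ (by simp), ← mul_assoc,
      ← MvPolynomial.C_mul, map_mul, hC]
  refine monic_of_natDegree_le_of_coeff_eq_one (wt v) ?_ ?_
  · rw [hsum]
    refine natDegree_sum_le_of_forall_le _ _ fun u hu => ?_
    exact (natDegree_C_mul_le _ _).trans
      ((nagataEquiv_prod_X_pow n he0 u).2.le.trans (hmax u hu))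
  · rw [hsum, finsetSum_coeff, Finset.sum_eq_single_of_mem v hv]
    · rw [coeff_C_mul, inv_mul_cancel₀ hc, MvPolynomial.C_1, one_mul]
      have h := nagataEquiv_prod_X_pow (K := K) n he0 v
      rw [show wt v = _ from h.2.symm]
      exact h.1
    · intro u hu huv
      rw [coeff_C_mul, coeff_eq_zero_of_natDegree_lt, mul_zero]
      rw [(nagataEquiv_prod_X_pow n he0 u).2]
      exact hne u hu huv

/-- A bound for the nilpotency index in an algebra over a polynomial ring in `r` variables which
has a presentation with at most `M` generators and relations of total degree at most `d`.
In the recursion, `M * d` bounds the degree of a minor, and `M * d * (M * d + 1) ^ r` bounds its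
degree after the change of variables. -/
def nilpotencyBound : ℕ → ℕ → ℕ → ℕ
  | 0, M, _ => M
  | r + 1, M, d => M + nilpotencyBound r (M * (M * d * (M * d + 1) ^ r))
      (d * (M * d + 1) ^ r + (d * (M * d + 1) ^ r + M * d * (M * d + 1) ^ r) *
        (M * d * (M * d + 1) ^ r))

/-- Division by a nonzero `δ` of degree at most `g` eliminates one variable at a controlled cost.
The factor `(g + 1) ^ r` is the growth of degrees under the change of variables. -/
theorem IsPresentation.exists_quotient {K : Type*} [Field K] {r : ℕ} {S ι : Type*} [CommRing S]
    [Fintype ι] {φ : MvPolynomial (Fin (r + 1)) K →+* S} {b : ι → S}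
    {Γ : Set (ι → MvPolynomial (Fin (r + 1)) K)} (h : IsPresentation φ b Γ) {d g : ℕ}
    (hd : ∀ w ∈ Γ, ∀ i, (w i).totalDegree ≤ d) {δ : MvPolynomial (Fin (r + 1)) K} (hδ : δ ≠ 0)
    (hg : δ.totalDegree ≤ g) :
    ∃ D ≤ g * (g + 1) ^ r, ∃ (ψ : MvPolynomial (Fin r) K →+* S ⧸ Ideal.span {φ δ})
      (b' : ι × Fin D → S ⧸ Ideal.span {φ δ}) (Γ' : Set (ι × Fin D → MvPolynomial (Fin r) K)),
      IsPresentation ψ b' Γ' ∧ ∀ w ∈ Γ', ∀ i, (w i).totalDegree ≤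
        d * (g + 1) ^ r + (d * (g + 1) ^ r + g * (g + 1) ^ r) * (g * (g + 1) ^ r) := by
  obtain ⟨c, hc, hmonic⟩ := exists_monic_nagataEquiv r hδ (Nat.lt_succ_of_le hg)
  have hdeg : (MvPolynomial.C c * δ).totalDegree ≤ g :=
    (MvPolynomial.totalDegree_mul _ _).trans (by simpa using hg)
  set e := nagataEquiv K r (g + 1) with he
  have hD := (natDegree_nagataEquiv_le r g.succ_pos (MvPolynomial.C c * δ)).trans
    (Nat.mul_le_mul_right _ hdeg)
  have hJ : Ideal.span {φ δ} =
      Ideal.span {(φ.comp e.toRingEquiv.symm.toRingHom) (e (MvPolynomial.C c * δ))} := by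
    have hu : IsUnit (φ (MvPolynomial.C c)) := (hc.isUnit.map MvPolynomial.C).map φ
    simp [Ideal.span_singleton_mul_left_unit hu]
  refine ⟨_, hD, _, _, _, (h.comp_symm e.toRingEquiv).quotient hmonic _ hJ, ?_⟩
  rintro _ ⟨_, ⟨γ, hγ, rfl⟩, k, hk, rfl⟩ ⟨i, j⟩
  have hdeg' : (e (γ i)).natDegree ≤ d * (g + 1) ^ r :=
    (natDegree_nagataEquiv_le r g.succ_pos _).trans (Nat.mul_le_mul_right _ (hd γ hγ i))
  refine totalDegree_coeff_modByMonic_le hmonic (fun k =>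
    (totalDegree_coeff_nagataEquiv_le r g.succ_pos _ k).trans (Nat.mul_le_mul_right _ hdeg))
    _ _ _ ?_ (fun k' => ?_) j
  · refine degree_le_natDegree.trans_lt ?_
    refine WithBot.coe_lt_coe.2 (natDegree_mul_le.trans_lt ?_)
    rw [natDegree_X_pow]
    exact (Nat.add_lt_add_of_lt_of_le (hk.trans_le hD) hdeg').trans_eq (Nat.add_comm _ _)
  · rw [coeff_X_pow_mul']
    split_ifs
    · exact (totalDegree_coeff_nagataEquiv_le r g.succ_pos _ _).trans
        (Nat.mul_le_mul_right _ (hd γ hγ i))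
    · simp

/-- The induction on the number of variables: `δ * f ^ M = 0` for a minor `δ`, and a bounded power
of `f` is divisible by `δ`. -/
theorem IsPresentation.pow_nilpotencyBound_eq_zero {K : Type*} [Field K] (r : ℕ) :
    ∀ {S ι : Type _} [CommRing S] [Fintype ι] {φ : MvPolynomial (Fin r) K →+* S} {b : ι → S}
    {Γ : Set (ι → MvPolynomial (Fin r) K)} (_ : IsPresentation φ b Γ) {M d : ℕ}
    (_ : Fintype.card ι ≤ M) (_ : ∀ w ∈ Γ, ∀ i, (w i).totalDegree ≤ d)
    {f : S} (_ : IsNilpotent f), f ^ nilpotencyBound r M d = 0 := by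
  induction r with
  | zero =>
    intro S ι _ _ φ b Γ h M d hM hd f hf
    obtain ⟨a, ha, h0⟩ := exists_mul_pow_card_eq_zero φ b h.exists_eq_sum f hf
    have hu : IsUnit (φ a) := by
      refine IsUnit.map φ ?_
      rw [MvPolynomial.eq_C_of_isEmpty a] at ha ⊢
      exact (IsUnit.mk0 _ fun h => ha (by rw [h, MvPolynomial.C_0])).map _
    exact pow_eq_zero_of_le hM ((hu.mul_right_eq_zero).1 h0)
  | succ r ih =>
    intro S ι _ _ φ b Γ h M d hM hd f hf
    obtain ⟨k, hk, γ, σ, hγ, hdet, htors⟩ := exists_det_smul_mem_span Γ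
    set δ := (Matrix.of fun i j => γ j (σ i)).det with hδ
    have hg : δ.totalDegree ≤ M * d :=
      (totalDegree_det_le _ fun i j => hd _ (hγ j) _).trans
        (Nat.mul_le_mul_right _ (by simpa using hk.trans hM))
    have h0 : φ δ * f ^ M = 0 := by
      rw [← Nat.sub_add_cancel hM, pow_add, mul_left_comm, h.mul_pow_card_eq_zero δ htors hf,
        mul_zero]
    obtain ⟨D, hD, ψ, b', Γ', h', hd'⟩ := h.exists_quotient hd hdet hg
    have hq := ih h' (by simpa using Nat.mul_le_mul hM hD) hd'
      (hf.map (Ideal.Quotient.mk (Ideal.span {φ δ})))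
    rw [← map_pow, Ideal.Quotient.eq_zero_iff_mem, Ideal.mem_span_singleton] at hq
    obtain ⟨s, hs⟩ := hq
    rw [nilpotencyBound, pow_add, hs, ← mul_assoc, mul_comm (f ^ M), h0, zero_mul]

/-- An effective Noether exponent: modulo an ideal generated in degree at most `d`, nilpotency
indices are bounded in terms of `d` and the number of variables. -/
theorem pow_nilpotencyBound_mem_span {K : Type*} [Field K] {n d : ℕ}
    {Λ : Set (MvPolynomial (Fin n) K)} (hΛ : ∀ p ∈ Λ, p.totalDegree ≤ d)
    {f : MvPolynomial (Fin n) K} {k : ℕ} (hf : f ^ k ∈ Ideal.span Λ) :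
    f ^ nilpotencyBound n 1 d ∈ Ideal.span Λ := by
  have h : IsPresentation (Ideal.Quotient.mk (Ideal.span Λ)) (fun _ : Unit => 1)
      ((fun p _ => p) '' Λ) := by
    refine ⟨fun s => ?_, fun w => ?_⟩
    · obtain ⟨p, rfl⟩ := Ideal.Quotient.mk_surjective s
      exact ⟨fun _ => p, by simp⟩
    · let L := (LinearEquiv.funUnique Unit (MvPolynomial (Fin n) K) (MvPolynomial (Fin n) K)).symm
      have hL : (fun p _ => p) '' Λ =
          (L.toLinearMap : _ → Unit → MvPolynomial (Fin n) K) '' Λ := rfl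
      rw [hL, Submodule.span_image, Submodule.mem_map_equiv]
      simp only [Finset.univ_unique, Finset.sum_singleton, mul_one, Ideal.Quotient.eq_zero_iff_mem]
      rfl
  rw [← Ideal.Quotient.eq_zero_iff_mem, map_pow]
  refine h.pow_nilpotencyBound_eq_zero n (by simp) ?_
    ⟨k, by rw [← map_pow, Ideal.Quotient.eq_zero_iff_mem]; exact hf⟩
  rintro _ ⟨p, hp, rfl⟩ -
  exact hΛ p hp

/-! ### Comparison of the bounds -/

theorem nilpotencyBound_zero_zero (r : ℕ) : nilpotencyBound r 0 0 = 0 := by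
  induction r with
  | zero => rfl
  | succ r ih => simpa [nilpotencyBound] using ih

/-- If `s` bounds the size of a presentation, `s ^ (6 * (r + 1))` bounds the one obtained by
eliminating one of `r + 1` variables. -/
theorem nilpotencyBound_le_pow (r : ℕ) : ∀ {M d s : ℕ}, 2 ≤ s → M ≤ s → d ≤ s →
    nilpotencyBound r M d ≤ s ^ (7 ^ r * r.factorial) := by
  induction r with
  | zero => intro M d s _ hM _; simpa [nilpotencyBound] using hM
  | succ r ih =>
    intro M d s hs hM hd
    set u := (M * d + 1) ^ r with hu
    have hMd : M * d ≤ s ^ 2 := by rw [sq]; exact Nat.mul_le_mul hM hd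
    have hu' : u ≤ s ^ (3 * r) := by
      rw [pow_mul]
      refine Nat.pow_le_pow_left ?_ r
      nlinarith [pow_pos (show 0 < s by omega) 2]
    have hgu : M * d * u ≤ s ^ (3 * r + 2) := by
      rw [add_comm, pow_add]; exact Nat.mul_le_mul hMd hu'
    have hdu : d * u ≤ s ^ (3 * r + 2) := by
      calc d * u ≤ s * s ^ (3 * r) := Nat.mul_le_mul hd hu'
        _ = s ^ (3 * r + 1) := by ring
        _ ≤ _ := Nat.pow_le_pow_right (by omega) (by omega)
    set t := s ^ (3 * r + 2) with ht
    have ht1 : 4 ≤ t := calc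
      4 = 2 ^ 2 := rfl
      _ ≤ s ^ 2 := Nat.pow_le_pow_left hs 2
      _ ≤ t := Nat.pow_le_pow_right (by omega) (by omega)
    have hs' : s ^ (6 * (r + 1)) = t * t * (s * s) := by rw [ht]; ring
    have hst : s ≤ t := by
      calc s = s ^ 1 := (pow_one s).symm
        _ ≤ t := Nat.pow_le_pow_right (by omega) (by omega)
    have hss : 4 ≤ s * s := Nat.mul_le_mul hs hs
    have h1 : M * (M * d * u) ≤ s ^ (6 * (r + 1)) := by
      rw [hs']
      calc M * (M * d * u) ≤ t * t := Nat.mul_le_mul (hM.trans hst) hgu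
        _ ≤ _ := Nat.le_mul_of_pos_right _ (by omega)
    have h2 : d * u + (d * u + M * d * u) * (M * d * u) ≤ s ^ (6 * (r + 1)) := by
      rw [hs']
      calc d * u + (d * u + M * d * u) * (M * d * u) ≤ t * t + (t + t) * t :=
            Nat.add_le_add (hdu.trans (Nat.le_mul_self t))
              (Nat.mul_le_mul (Nat.add_le_add hdu hgu) hgu)
        _ = t * t * 3 := by ring
        _ ≤ _ := Nat.mul_le_mul_left _ (by omega)
    have h3 := ih (s := s ^ (6 * (r + 1)))
      (by rw [hs']; nlinarith [Nat.mul_le_mul ht1 ht1]) h1 h2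
    rw [nilpotencyBound]
    set E := 7 ^ r * r.factorial with hE
    have hE1 : 1 ≤ E := Nat.mul_pos (by positivity) r.factorial_pos
    rw [← pow_mul] at h3
    have h4 : 6 * (r + 1) * E + 1 ≤ 7 ^ (r + 1) * (r + 1).factorial := by
      rw [Nat.factorial_succ, pow_succ]
      calc 6 * (r + 1) * E + 1 ≤ 6 * (r + 1) * E + (r + 1) * E := by
            have : 1 * 1 ≤ (r + 1) * E := Nat.mul_le_mul (by omega) hE1
            omega
        _ = _ := by rw [hE]; ring
    calc M + _ ≤ s ^ (6 * (r + 1) * E) + s ^ (6 * (r + 1) * E) := by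
          refine Nat.add_le_add (hM.trans ?_) h3
          exact Nat.le_self_pow (by positivity) s
      _ = 2 * s ^ (6 * (r + 1) * E) := by ring
      _ ≤ s * s ^ (6 * (r + 1) * E) := Nat.mul_le_mul_right _ hs
      _ = s ^ (6 * (r + 1) * E + 1) := by ring
      _ ≤ _ := Nat.pow_le_pow_right (by omega) h4

theorem le_pBound (n d : ℕ) : d ≤ pBound n d := by
  match n with
  | 0 => simp [pBound]
  | 1 => simp [pBound]
  | n + 2 =>
    rw [pBound]
    refine le_trans ?_ (le_max_right _ _)
    rw [eBound]
    omega

theorem add_one_le_choose (k D : ℕ) (hk : 1 ≤ k) : D + 1 ≤ (k + D).choose k := by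
  rw [Nat.choose_symm_add]
  calc D + 1 = (1 + D).choose D := by rw [add_comm 1 D, Nat.choose_succ_self_right]
    _ ≤ _ := Nat.choose_le_choose D (by omega)

theorem add_two_mul_le_zeta1 (k q d : ℕ) (hk : 1 ≤ k) (hd : 1 ≤ d) (hq : d ≤ q) :
    d + 2 * (k + 1) ≤ zeta1 k q d := by
  have hD : 2 * d ≤ dBound k q :=
    (Nat.mul_le_mul_left 2 hq).trans (Nat.le_self_pow (by positivity) _)
  have h1 : dBound k q + 1 ≤ zeta0 k q := add_one_le_choose k _ hk
  have h2 : k + 1 ≤ zeta0 k q := by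
    rw [zeta0, Nat.choose_symm_add, add_comm k (dBound k q)]
    exact add_one_le_choose _ k (by omega)
  have h3 : 1 ≤ (d + k).choose k := Nat.choose_pos (by omega)
  calc d + 2 * (k + 1) ≤ 3 * zeta0 k q := by omega
    _ ≤ zeta1 k q d := Nat.mul_le_mul_right _ (by omega)

theorem two_pow_le_pBound (n d : ℕ) (hd : 1 ≤ d) :
    2 ^ (2 ^ (d + 2 * (n + 2)) - 1) ≤ pBound (n + 2) d := by
  rw [pBound]
  refine le_trans ?_ (le_max_left _ _)
  set q := pBound (n + 1) d with hq
  have hz := add_two_mul_le_zeta1 (n + 1) q d (by omega) hd (le_pBound _ _)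
  set z := zeta1 (n + 1) q d with hz'
  have hυ : upsilon (n + 2) q d = z * (z + 1) ^ (2 ^ z - 1) := rfl
  set υ := upsilon (n + 2) q d with hυ'
  calc 2 ^ (2 ^ (d + 2 * (n + 2)) - 1) ≤ (z + 1) ^ (2 ^ (d + 2 * (n + 2)) - 1) :=
        Nat.pow_le_pow_left (by omega) _
    _ ≤ (z + 1) ^ (2 ^ z - 1) :=
        Nat.pow_le_pow_right (by omega)
          (Nat.sub_le_sub_right (Nat.pow_le_pow_right (by omega) (by omega)) 1)
    _ ≤ υ := by rw [hυ]; exact Nat.le_mul_of_pos_left _ (by omega)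
    _ ≤ 2 * (υ + (n + 2)).choose (n + 2) * υ :=
        Nat.le_mul_of_pos_left _ (Nat.mul_pos (by omega) (Nat.choose_pos (by omega)))

theorem mul_seven_pow_mul_factorial_le_pBound (n d : ℕ) (hd : 1 ≤ d) :
    (d + 1) * (7 ^ (n + 2) * (n + 2).factorial) ≤ pBound (n + 2) d := by
  refine le_trans ?_ (two_pow_le_pBound n d hd)
  generalize n + 2 = N
  have h1 : d + 1 ≤ 2 ^ d := Nat.lt_two_pow_self
  have h7 : 7 ^ N ≤ 2 ^ (3 * N) := by rw [pow_mul]; exact Nat.pow_le_pow_left (by norm_num) N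
  have hf : N.factorial ≤ 2 ^ (N * N) := by
    rw [pow_mul]
    exact (Nat.factorial_le_pow N).trans (Nat.pow_le_pow_left Nat.lt_two_pow_self.le N)
  calc (d + 1) * (7 ^ N * N.factorial) ≤ 2 ^ d * (2 ^ (3 * N) * 2 ^ (N * N)) := by gcongr
    _ = 2 ^ (d + (3 * N + N * N)) := by rw [← pow_add, ← pow_add]
    _ ≤ _ := by
      refine Nat.pow_le_pow_right (by omega) (Nat.le_sub_one_of_lt ?_)
      have h2 : N + 1 ≤ 2 ^ N := Nat.lt_two_pow_self
      calc d + (3 * N + N * N) < (d + 1) * ((N + 1) * (N + 1)) := by nlinarith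
        _ ≤ 2 ^ d * (2 ^ N * 2 ^ N) := by gcongr
        _ = 2 ^ (d + 2 * N) := by rw [← pow_add, ← pow_add]; congr 1; omega

/-- Each step of the recursion removes at most one element. -/
theorem card_le_mBound (D : ℕ → ℕ) (τ : Multiset ℕ) (i : ℕ) : Multiset.card τ ≤ mBound D τ i := by
  induction τ, i using mBound.induct D with
  | case1 i => simp
  | case2 τ i hτ ih =>
    rw [mBound, dif_neg hτ]
    have h : Multiset.card τ ≤
        1 + Multiset.card (multisetStep D τ (multisetMin τ hτ) i) := by
      have hmem := multisetMin_mem τ hτ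
      have := Multiset.card_erase_add_one hmem
      unfold multisetStep
      split_ifs with h0
      · rw [h0] at this
        omega
      · rw [Multiset.card_add]
        omega
    omega

theorem mBound_eq_of_forall_mem {D : ℕ → ℕ} {τ : Multiset ℕ} {k : ℕ} (i : ℕ) (hτ : τ ≠ 0)
    (hk : ∀ x ∈ τ, x = k) : mBound D τ i = 1 + mBound D (multisetStep D τ k i) (i + 1) := by
  rw [mBound, dif_neg hτ, hk _ (multisetMin_mem τ hτ)]

theorem mBound_singleton {D : ℕ → ℕ} {k : ℕ} (hk : k ≠ 0) (i : ℕ) :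
    mBound D {k} i = 1 + mBound D (Multiset.replicate (k * (D i - 1)) (k - 1)) (i + 1) := by
  rw [mBound_eq_of_forall_mem i (by simp) (k := k) (by simp)]
  simp [multisetStep, hk]

theorem add_two_le_mStar_one (d : ℕ) : d + 2 ≤ mStar (fun j => (pBound 1)^[j] d) 1 := by
  rw [mStar, mBound_singleton one_ne_zero]
  refine Nat.succ_le_succ ?_
  rw [add_comm 1 (mBound _ _ _)]
  refine Nat.succ_le_succ (le_trans ?_ (card_le_mBound _ _ _))
  rw [Multiset.card_replicate, one_mul, Function.iterate_zero_apply, Nat.add_sub_cancel]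

/-- The first step of the recursion leaves copies of `n + 1` only, and the second one replaces a
copy by `(n + 1) * pBound (n + 2) d` copies of `n`. -/
theorem pBound_le_mStar (n d : ℕ) (hd : 1 ≤ d) :
    pBound (n + 2) d ≤ mStar (fun j => (pBound (n + 2))^[j] d) (n + 2) := by
  rw [mStar, mBound_singleton (by omega)]
  set D : ℕ → ℕ := fun i => (pBound (n + 2))^[i] d + 1 with hD
  have hD1 : D 1 - 1 = pBound (n + 2) d := rfl
  have hne : Multiset.replicate ((n + 2) * (D 0 - 1)) (n + 2 - 1) ≠ 0 := by
    rw [← Multiset.card_pos, Multiset.card_replicate]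
    exact Nat.mul_pos (by omega) hd
  rw [mBound_eq_of_forall_mem _ hne fun x hx => Multiset.eq_of_mem_replicate hx]
  have h := card_le_mBound D
    (multisetStep D (Multiset.replicate ((n + 2) * (D 0 - 1)) (n + 2 - 1)) (n + 2 - 1) (0 + 1))
    (0 + 1 + 1)
  have h2 : pBound (n + 2) d ≤ Multiset.card (multisetStep D
      (Multiset.replicate ((n + 2) * (D 0 - 1)) (n + 2 - 1)) (n + 2 - 1) (0 + 1)) := by
    rw [multisetStep, if_neg (by omega), Multiset.card_add, Multiset.card_replicate, zero_add, hD1]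
    exact (Nat.le_mul_of_pos_left _ (by omega)).trans (Nat.le_add_left _ _)
  omega

theorem nilpotencyBound_le_two_pow_mStar (n d : ℕ) :
    nilpotencyBound n 1 d ≤ 2 ^ mStar (fun j => (pBound n)^[j] d) n := by
  match n with
  | 0 => exact Nat.one_le_two_pow
  | 1 =>
    calc nilpotencyBound 1 1 d = d + 1 := by simp [nilpotencyBound, add_comm]
      _ ≤ 2 ^ d := Nat.lt_two_pow_self
      _ ≤ _ := Nat.pow_le_pow_right (by omega)
        ((Nat.le_add_right d 2).trans (add_two_le_mStar_one d))
  | n + 2 =>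
    rcases Nat.eq_zero_or_pos d with rfl | hd
    · rw [nilpotencyBound]
      simpa [nilpotencyBound_zero_zero] using Nat.one_le_two_pow
    · calc nilpotencyBound (n + 2) 1 d
          ≤ (d + 2) ^ (7 ^ (n + 2) * (n + 2).factorial) :=
            nilpotencyBound_le_pow _ (by omega) (by omega) (by omega)
        _ ≤ (2 ^ (d + 1)) ^ (7 ^ (n + 2) * (n + 2).factorial) :=
            Nat.pow_le_pow_left Nat.lt_two_pow_self _
        _ = 2 ^ ((d + 1) * (7 ^ (n + 2) * (n + 2).factorial)) := (pow_mul _ _ _).symm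
        _ ≤ _ := Nat.pow_le_pow_right (by omega)
            ((mul_seven_pow_mul_factorial_le_pBound n d hd).trans (pBound_le_mStar n d hd))

end EffectiveRadical

theorem mainTheorem3 (n d : ℕ) {K : Type*} [Field K]
    (Λ : Set (MvPolynomial (Fin n) K)) (hΛ : ∀ p ∈ Λ, p.totalDegree ≤ d)
    (f : MvPolynomial (Fin n) K) (k : ℕ) (hf : f ^ k ∈ Ideal.span Λ) :
    ∃ (s : ℕ) (c r : Fin s → MvPolynomial (Fin n) K),
      f = ∑ i, c i * r i ∧
      ∀ i, r i ^ 2 ^ EffectiveRadical.mStar (fun j => (EffectiveRadical.pBound n)^[j] d) n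
        ∈ Ideal.span Λ :=
  -- The exponent already works for `f` itself.
  ⟨1, fun _ => 1, fun _ => f, by simp, fun _ =>
    Ideal.pow_mem_of_pow_mem _ (EffectiveRadical.pow_nilpotencyBound_mem_span hΛ hf)
      (EffectiveRadical.nilpotencyBound_le_two_pow_mStar n d)⟩
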